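/- **Setting.** Let $Q$ be a smooth finite-dimensional manifold and let $B$ be a Poisson tensor on $T^*Q$, with bracket $\{f,g\}=B(\mathrm df,\mathrm dg)$ and bundle map $B^\sharp:T^*T^*Q\to TT^*Q$, $B(\alpha,\beta)=\langle\alpha,B^\sharp\beta\rangle$. A CH system $(T^*Q,B,H,F,W)$ consists of $B$, a smooth Hamiltonian $H:T^*Q\to\mathbb R$, a smooth fiber-preserving force map $F:T^*Q\to T^*Q$, and a control subset $W\subset T^*Q$, an embedded submanifold (with the relative topology) for which $W\to Q$ is a surjective submersion. Fix a smooth splitting of $TT^*Q$ into the vertical bundle and a horizontal bundle. With $X_H=B^\sharp\mathrm dH$, the dynamical vector field of a control law, i.e. a smooth fiber-preserving map $u:T^*Q\to W$, is $X_u=X_H+\mathrm{vlift}(F)X_H+\mathrm{vlift}(u)X_H$, where $\mathrm{vlift}(\varphi)X_H(\alpha)$ is the vertical part of $T\varphi(X_H(\alpha))$ translated along the fiber from $\varphi(\alpha)$ to $\alpha$. $W$ is a *controllability submanifold* if (provided control laws exist) any two states $x_0,x_1\in T^*Q$ are joined by a curve $x:[0,1]\to T^*Q$ consisting of finitely many pieces,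 each of which is an integral curve of $X_u$ for some control law $u$. Let $D\subset TT^*Q|_W$ be a generalized distribution (a linear subspace $D(w)\subset T_wT^*Q$ for each $w\in W$) and $D_W=D\cap TW$. $D_W$ is *smooth* if each of its vectors extends to a smooth local section of $D_W$, *regular* if its rank is locally constant, and *integrable* if through each point of $W$ passes a connected immersed submanifold of $W$ whose tangent spaces are the fibers of $D_W$. $D$ is *Poisson* if for all open $U\subset T^*Q$ and $f,g\in C^\infty(U)$ whose differentials vanish on $D$ at the points of $U\cap W$, the differential of $\{f,g\}$ vanishes on $D$ at the points of $U\cap W$. $D$ is a *controllability distribution* if $W$ is a controllability submanifold, $D$ is Poisson, and $D_W$ is smooth and integrable. Let $\pi:W\to W/D_W$ be the projection to the space of leaves of $D_W$ (two points lie on the same leaf if they are joined by finitely many integral curves of local sections of $D_W$), with the quotient topology. A subset of $W$ is $D_W$-invariant if it is invariant under the flows of local sections of $D_W$. For $V\subset W/D_W$ open, a *local extension* at $m\in\pi^{-1}(V)$ of $f\circ\pi$, $f:V\to\mathbb R$, is a function $K\in C^\infty(U_m)$ on an open neighborhood $U_m$ of $m$ in $T^*Q$ such that $U_m\cap W$ is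 $D_W$-invariant and $f\circ\pi=K$ on $\pi^{-1}(V)\cap U_m$; it is *$D$-invariant* if $\mathrm dK(y)|_{D(y)}=0$ for all $y\in\pi^{-1}(V)\cap U_m$. $C^\infty_{W/D_W}(V)$ is the algebra of all $f:V\to\mathbb R$ such that for each $z\in V$ there is a local extension of $f\circ\pi$ at some $m\in\pi^{-1}(z)$. The presheaf $C^\infty_{W/D_W}$ has the *$(D,D_W)$-local extension property* if these local extensions can always be chosen $D$-invariant. The CH system is *Poisson reducible by $D$* if there are brackets $\{\cdot,\cdot\}_V$ on $C^\infty_{W/D_W}(V)$, $V\subset W/D_W$ open, making $C^\infty_{W/D_W}$ a presheaf of Poisson algebras, with $$\{f,h\}_V(\pi(m))=\{K,L\}(m)$$ for all $m\in\pi^{-1}(V)$ and all local $D$-invariant extensions $K,L\in C^\infty(U_m)$ of $f\circ\pi$, $h\circ\pi$ at $m$. **Theorem 3.4.** Let $(T^*Q,B,H,F,W)$ be a CH system, $W$ its controllability submanifold and $D\subset TT^*Q|_W$ a controllability distribution such that $D_W=D\cap TW$ is smooth, regular and integrable and the presheaf $C^\infty_{W/D_W}$ has the $(D,D_W)$-local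 extension property. Then the CH system is Poisson reducible by $D$ if and only if $$B^\sharp(\Delta_z)\subset(\Delta_z)_W^\circ\qquad\text{for all } z\in W,$$ where $\Delta_z\subset T_z^*T^*Q$ is the set of all $\mathrm df(z)$ with $f\in C^\infty(U_z)$, $U_z$ an open neighborhood of $z$ in $T^*Q$, and $\mathrm df(y)|_{D(y)}=0$ for all $y\in U_z\cap W$; where $(\Delta_z)_W\subset\Delta_z$ consists of those $\mathrm df(z)$ for which moreover $f|_{U_z\cap W}$ is constant; and where $(\Delta_z)_W^\circ=\{v\in T_zT^*Q\mid \langle\beta,v\rangle=0\ \text{for all }\beta\in(\Delta_z)_W\}$. -/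

import Mathlib

open Set Topology TopologicalSpace
open scoped Manifold ContDiff Bundle

namespace PoissonReduction

noncomputable section

/-! ### Poisson manifolds -/

section Poisson

variable {EP HP P : Type*} [NormedAddCommGroup EP] [NormedSpace ℝ EP]
  [TopologicalSpace HP] (J : ModelWithCorners ℝ EP HP)
  [TopologicalSpace P] [ChartedSpace HP P]

/-- A Poisson tensor `B` on `P`, recorded through its bundle map `B♯ : T*P → TP`, where
`B(α, β) = ⟨α, B♯ β⟩`. The bracket `{f, g} = B(df, dg) = df (B♯ dg)` of smooth functions is smooth,
antisymmetric and satisfies the Jacobi identity; being a biderivation is automatic. -/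
structure PoissonTensor (P : Type*) [TopologicalSpace P] [ChartedSpace HP P] where
  /-- The bundle map `B♯`. -/
  sharp : ∀ x : P, (TangentSpace J x →L[ℝ] ℝ) →ₗ[ℝ] TangentSpace J x
  antisymm : ∀ (x : P) (α β : TangentSpace J x →L[ℝ] ℝ), α (sharp x β) = -β (sharp x α)
  smooth : ∀ (U : Set P), IsOpen U → ∀ f g : P → ℝ,
    ContMDiffOn J 𝓘(ℝ, ℝ) ∞ f U → ContMDiffOn J 𝓘(ℝ, ℝ) ∞ g U →
    ContMDiffOn J 𝓘(ℝ, ℝ) ∞ (fun x => mvfderiv J f x (sharp x (mvfderiv J g x))) U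
  jacobi : ∀ (U : Set P), IsOpen U → ∀ f g h : P → ℝ,
    ContMDiffOn J 𝓘(ℝ, ℝ) ∞ f U → ContMDiffOn J 𝓘(ℝ, ℝ) ∞ g U →
    ContMDiffOn J 𝓘(ℝ, ℝ) ∞ h U → ∀ x ∈ U,
    mvfderiv J f x (sharp x
        (mvfderiv J (fun y => mvfderiv J g y (sharp y (mvfderiv J h y))) x)) +
      mvfderiv J g x (sharp x
        (mvfderiv J (fun y => mvfderiv J h y (sharp y (mvfderiv J f y))) x)) +
      mvfderiv J h x (sharp x
        (mvfderiv J (fun y => mvfderiv J f y (sharp y (mvfderiv J g y))) x)) = 0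

variable {J}

/-- The Poisson bracket `{f, g}(x) = B(x)(df(x), dg(x))`. -/
def PoissonTensor.bracket (B : PoissonTensor J P) (f g : P → ℝ) (x : P) : ℝ :=
  mvfderiv J f x (B.sharp x (mvfderiv J g x))

end Poisson

/-! ### Distributions on a manifold -/

section Distribution

variable {E' S : Type*} [NormedAddCommGroup E'] [NormedSpace ℝ E']
  [TopologicalSpace S] [ChartedSpace E' S] [IsManifold 𝓘(ℝ, E') ∞ S]

/-- `X` is a smooth section of the generalized distribution `Δ`, defined on the open set `O`. -/
structure IsLocalSection (Δ : ∀ y : S, Submodule ℝ (TangentSpace 𝓘(ℝ, E') y))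
    (O : Set S) (X : ∀ y : S, TangentSpace 𝓘(ℝ, E') y) : Prop where
  isOpen : IsOpen O
  smooth : ContMDiffOn 𝓘(ℝ, E') 𝓘(ℝ, E').tangent ∞
    (fun y => (⟨y, X y⟩ : TangentBundle 𝓘(ℝ, E') S)) O
  mem : ∀ y ∈ O, X y ∈ Δ y

/-- The distribution is smooth: each of its vectors extends to a smooth local section. -/
def IsSmoothDistribution (Δ : ∀ y : S, Submodule ℝ (TangentSpace 𝓘(ℝ, E') y)) : Prop :=
  ∀ y, ∀ v ∈ Δ y, ∃ O X, IsLocalSection Δ O X ∧ y ∈ O ∧ X y = v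

/-- The distribution is regular: its rank is locally constant. -/
def IsRegularDistribution (Δ : ∀ y : S, Submodule ℝ (TangentSpace 𝓘(ℝ, E') y)) : Prop :=
  ∀ y, ∀ᶠ y' in 𝓝 y, Module.finrank ℝ (Δ y') = Module.finrank ℝ (Δ y)

/-- The distribution is completely integrable: through each point there passes a connected
injectively immersed submanifold `j : N → S` whose tangent space at each of its points is the
fibre of the distribution. -/
def IsIntegrableDistribution (Δ : ∀ y : S, Submodule ℝ (TangentSpace 𝓘(ℝ, E') y)) : Prop :=
  ∀ y : S, ∃ (k : ℕ) (N : Type) (_ : TopologicalSpace N)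
    (_ : ChartedSpace (EuclideanSpace ℝ (Fin k)) N)
    (_ : IsManifold 𝓘(ℝ, EuclideanSpace ℝ (Fin k)) ∞ N) (_ : ConnectedSpace N) (j : N → S),
    ContMDiff 𝓘(ℝ, EuclideanSpace ℝ (Fin k)) 𝓘(ℝ, E') ∞ j ∧ Function.Injective j ∧
    y ∈ range j ∧
    ∀ p, Function.Injective (mfderiv 𝓘(ℝ, EuclideanSpace ℝ (Fin k)) 𝓘(ℝ, E') j p) ∧
      range (mfderiv 𝓘(ℝ, EuclideanSpace ℝ (Fin k)) 𝓘(ℝ, E') j p) = (Δ (j p) : Set _)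

/-- The flow of some local section of `Δ` takes `x` to `y`. -/
def FlowStep (Δ : ∀ y : S, Submodule ℝ (TangentSpace 𝓘(ℝ, E') y)) (x y : S) : Prop :=
  ∃ (O : Set S) (X : ∀ y : S, TangentSpace 𝓘(ℝ, E') y) (γ : ℝ → S) (a b : ℝ),
    IsLocalSection Δ O X ∧ a ≤ b ∧ IsMIntegralCurveOn (I := 𝓘(ℝ, E')) γ X (Icc a b) ∧
    MapsTo γ (Icc a b) O ∧ γ a = x ∧ γ b = y

/-- A subset is invariant if it is invariant under the flow of every local section. -/
def IsInvariantSet (Δ : ∀ y : S, Submodule ℝ (TangentSpace 𝓘(ℝ, E') y)) (A : Set S) : Prop :=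
  ∀ x y, FlowStep Δ x y → x ∈ A → y ∈ A

/-- Two points are equivalent if they lie on the same accessible set (maximal integral manifold)
of `Δ`, i.e. are joined by a finite union of integral curves of local sections. -/
def leafSetoid (Δ : ∀ y : S, Submodule ℝ (TangentSpace 𝓘(ℝ, E') y)) : Setoid S :=
  Relation.EqvGen.setoid (FlowStep Δ)

/-- The leaf space, with the quotient topology. -/
abbrev LeafSpace (Δ : ∀ y : S, Submodule ℝ (TangentSpace 𝓘(ℝ, E') y)) : Type _ :=
  Quotient (leafSetoid Δ)

/-- The projection to the leaf space. -/
def leafProj (Δ : ∀ y : S, Submodule ℝ (TangentSpace 𝓘(ℝ, E') y)) (x : S) : LeafSpace Δ :=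
  Quotient.mk (leafSetoid Δ) x

theorem isLocalSection_neg {Δ : ∀ y : S, Submodule ℝ (TangentSpace 𝓘(ℝ, E') y)} {O : Set S}
    {X : ∀ y : S, TangentSpace 𝓘(ℝ, E') y}
    (h : IsLocalSection Δ O X) : IsLocalSection Δ O (-X) := by
  refine ⟨h.isOpen, ?_, fun y hy => (Δ y).neg_mem (h.mem y hy)⟩
  exact ContMDiffOn.neg_section h.smooth

theorem flowStep_symm {Δ : ∀ y : S, Submodule ℝ (TangentSpace 𝓘(ℝ, E') y)}
    {x y : S} (h : FlowStep Δ x y) : FlowStep Δ y x := by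
  obtain ⟨O, X, γ, a, b, hX, hab, hγ, hO, hx, hy⟩ := h
  refine ⟨O, -X, γ ∘ (fun t => t * (-1)), -b, -a, isLocalSection_neg hX, by linarith, ?_, ?_,
    by simpa using hy, by simpa using hx⟩
  · have := hγ.comp_mul (-1)
    convert this using 1
    · simp
    · ext t; simp only [mem_Icc, mem_ofPred_eq]; constructor <;> rintro ⟨h1, h2⟩ <;>
        constructor <;> linarith
  · intro t ht
    apply hO
    simp only [mem_Icc] at ht ⊢
    constructor <;> linarith

/-- An invariant set is a union of leaves. -/
theorem IsInvariantSet.mem_iff {Δ : ∀ y : S, Submodule ℝ (TangentSpace 𝓘(ℝ, E') y)}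
    {A : Set S} (hA : IsInvariantSet Δ A) {x y : S}
    (h : leafProj Δ x = leafProj Δ y) : x ∈ A ↔ y ∈ A := by
  have h' : Relation.EqvGen (FlowStep Δ) x y := Quotient.exact h
  clear h
  induction h' with
  | rel x y h => exact ⟨hA x y h, hA y x (flowStep_symm h)⟩
  | refl x => exact Iff.rfl
  | symm x y _ ih => exact ih.symm
  | trans x y z _ _ ih1 ih2 => exact ih1.trans ih2

end Distribution

/-! ### Reduction of a Poisson manifold by a distribution along a submanifold

Throughout, `ι : S → P` is the inclusion of a submanifold and `D ⊂ TP|_S` is a generalized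
distribution along `S`, given by its fibres `D s ⊂ T_{ι s} P`. -/

section Reduction

variable {EP HP P : Type*} [NormedAddCommGroup EP] [NormedSpace ℝ EP]
  [TopologicalSpace HP] {J : ModelWithCorners ℝ EP HP}
  [TopologicalSpace P] [ChartedSpace HP P]
  {E' S : Type*} [NormedAddCommGroup E'] [NormedSpace ℝ E']
  [TopologicalSpace S] [ChartedSpace E' S] [IsManifold 𝓘(ℝ, E') ∞ S]

/-- `ι` exhibits `S` as an embedded submanifold of `P` (with the relative topology). -/
structure IsEmbeddedSubmanifold (J : ModelWithCorners ℝ EP HP) (ι : S → P) : Prop where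
  isEmbedding : IsEmbedding ι
  smooth : ContMDiff 𝓘(ℝ, E') J ∞ ι
  immersion : ∀ s, Function.Injective (mfderiv 𝓘(ℝ, E') J ι s)

/-- `D_S = D ∩ TS`, as a generalized distribution on `S`. -/
def tangentPart (ι : S → P) (D : ∀ s : S, Submodule ℝ (TangentSpace J (ι s))) (s : S) :
    Submodule ℝ (TangentSpace 𝓘(ℝ, E') s) :=
  (D s).comap (mfderiv 𝓘(ℝ, E') J ι s).toLinearMap

/-- `df` vanishes on `D` at all points of `S ∩ U`. -/
def KillsOn (ι : S → P) (D : ∀ s : S, Submodule ℝ (TangentSpace J (ι s)))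
    (f : P → ℝ) (U : Set P) : Prop :=
  ∀ s, ι s ∈ U → ∀ v ∈ D s, mvfderiv J f (ι s) v = 0

/-- `D` is Poisson (canonical): if `df` and `dg` vanish on `D`, then so does `d{f, g}`. -/
def IsPoissonDistribution (B : PoissonTensor J P) (ι : S → P)
    (D : ∀ s : S, Submodule ℝ (TangentSpace J (ι s))) : Prop :=
  ∀ U : Set P, IsOpen U → ∀ f g : P → ℝ,
    ContMDiffOn J 𝓘(ℝ, ℝ) ∞ f U → ContMDiffOn J 𝓘(ℝ, ℝ) ∞ g U →
    KillsOn ι D f U → KillsOn ι D g U → KillsOn ι D (B.bracket f g) U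

/-- `F`, smooth on the open neighbourhood `U` of `m` in `P` for which `U ∩ S` is `D_S`-invariant,
is a local extension at `m` of `f ∘ π`, where `f` is a function on the open subset `V` of
`S / D_S`. -/
structure IsLocalExtension (ι : S → P) (D : ∀ s : S, Submodule ℝ (TangentSpace J (ι s)))
    (V : Opens (LeafSpace (tangentPart (E' := E') ι D))) (f : V → ℝ)
    (m : S) (U : Set P) (F : P → ℝ) : Prop where
  isOpen : IsOpen U
  mem : ι m ∈ U
  invariant : IsInvariantSet (tangentPart (E' := E') ι D) (ι ⁻¹' U)
  smooth : ContMDiffOn J 𝓘(ℝ, ℝ) ∞ F U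
  eq : ∀ (s : S) (hs : leafProj (tangentPart (E' := E') ι D) s ∈ V), ι s ∈ U → f ⟨_, hs⟩ = F (ι s)

/-- `F` is a local `D`-invariant extension of `f ∘ π` at `m`: moreover `dF` vanishes on `D` at the
points of `π⁻¹(V) ∩ U`. -/
structure IsInvariantExtension (ι : S → P) (D : ∀ s : S, Submodule ℝ (TangentSpace J (ι s)))
    (V : Opens (LeafSpace (tangentPart (E' := E') ι D))) (f : V → ℝ)
    (m : S) (U : Set P) (F : P → ℝ) : Prop extends IsLocalExtension ι D V f m U F where
  kills : ∀ s : S, leafProj (tangentPart (E' := E') ι D) s ∈ V → ι s ∈ U →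
    ∀ v ∈ D s, mvfderiv J F (ι s) v = 0

/-- `f ∈ C^∞_{S/D_S}(V)`. -/
def IsSmoothOnLeafSpace (ι : S → P) (D : ∀ s : S, Submodule ℝ (TangentSpace J (ι s)))
    (V : Opens (LeafSpace (tangentPart (E' := E') ι D))) (f : V → ℝ) : Prop :=
  ∀ z ∈ V, ∃ m : S, leafProj (tangentPart (E' := E') ι D) m = z ∧
    ∃ U F, IsLocalExtension ι D V f m U F

/-- The `(D, D_S)`-local extension property of the presheaf `C^∞_{S/D_S}`. -/
def HasLocalExtensionProperty (ι : S → P)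
    (D : ∀ s : S, Submodule ℝ (TangentSpace J (ι s))) : Prop :=
  ∀ (V : Opens (LeafSpace (tangentPart (E' := E') ι D))) (f : V → ℝ),
    IsSmoothOnLeafSpace ι D V f →
    ∀ z ∈ V, ∃ m : S, leafProj (tangentPart (E' := E') ι D) m = z ∧
      ∃ U F, IsInvariantExtension ι D V f m U F

theorem IsLocalExtension.inter {ι : S → P}
    {D : ∀ s : S, Submodule ℝ (TangentSpace J (ι s))}
    {V : Opens (LeafSpace (tangentPart (E' := E') ι D))} {f g : V → ℝ}
    {m m' : S} {U U' : Set P} {F G : P → ℝ}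
    (hF : IsLocalExtension ι D V f m U F) (hG : IsLocalExtension ι D V g m' U' G)
    (hm : leafProj (tangentPart (E' := E') ι D) m = leafProj (tangentPart (E' := E') ι D) m') :
    IsLocalExtension ι D V f m (U ∩ U') F ∧ IsLocalExtension ι D V g m (U ∩ U') G := by
  have hmem : ι m ∈ U' := (hG.invariant.mem_iff hm).2 hG.mem
  have hinv : IsInvariantSet (tangentPart (E' := E') ι D) (ι ⁻¹' (U ∩ U')) :=
    fun x y h hx => ⟨hF.invariant x y h hx.1, hG.invariant x y h hx.2⟩
  exact ⟨⟨hF.isOpen.inter hG.isOpen, ⟨hF.mem, hmem⟩, hinv, hF.smooth.mono inter_subset_left,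
      fun s hs h => hF.eq s hs h.1⟩,
    ⟨hF.isOpen.inter hG.isOpen, ⟨hF.mem, hmem⟩, hinv, hG.smooth.mono inter_subset_right,
      fun s hs h => hG.eq s hs h.2⟩⟩

/-- The algebra `C^∞_{S/D_S}(V)`. -/
def leafFunctions (ι : S → P)
    (D : ∀ s : S, Submodule ℝ (TangentSpace J (ι s)))
    (V : Opens (LeafSpace (tangentPart (E' := E') ι D))) : Subalgebra ℝ (V → ℝ) where
  carrier := {f | IsSmoothOnLeafSpace ι D V f}
  add_mem' := by
    intro f g hf hg z hz
    obtain ⟨m, hm, U, F, hF⟩ := hf z hz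
    obtain ⟨m', hm', U', G, hG⟩ := hg z hz
    obtain ⟨h1, h2⟩ := hF.inter hG (hm.trans hm'.symm)
    exact ⟨m, hm, U ∩ U', F + G, h1.isOpen, h1.mem, h1.invariant, h1.smooth.add h2.smooth,
      fun s hs h => congrArg₂ (· + ·) (h1.eq s hs h) (h2.eq s hs h)⟩
  mul_mem' := by
    intro f g hf hg z hz
    obtain ⟨m, hm, U, F, hF⟩ := hf z hz
    obtain ⟨m', hm', U', G, hG⟩ := hg z hz
    obtain ⟨h1, h2⟩ := hF.inter hG (hm.trans hm'.symm)
    exact ⟨m, hm, U ∩ U', F * G, h1.isOpen, h1.mem, h1.invariant, h1.smooth.mul h2.smooth,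
      fun s hs h => congrArg₂ (· * ·) (h1.eq s hs h) (h2.eq s hs h)⟩
  algebraMap_mem' := by
    intro r z hz
    obtain ⟨m, rfl⟩ := Quotient.exists_rep z
    exact ⟨m, rfl, univ, fun _ => r, isOpen_univ, mem_univ _, fun _ _ _ _ => mem_univ _,
      contMDiffOn_const, fun s hs h => rfl⟩

/-- The restriction maps of the presheaf `C^∞_{S/D_S}`. -/
def leafRestrict (ι : S → P)
    (D : ∀ s : S, Submodule ℝ (TangentSpace J (ι s)))
    {V V' : Opens (LeafSpace (tangentPart (E' := E') ι D))} (hV : V' ≤ V)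
    (f : leafFunctions (E' := E') ι D V) : leafFunctions (E' := E') ι D V' :=
  ⟨fun z => f.1 ⟨z.1, hV z.2⟩, by
    intro z hz
    obtain ⟨m, hm, U, F, hF⟩ := f.2 z (hV hz)
    exact ⟨m, hm, U, F, hF.isOpen, hF.mem, hF.invariant, hF.smooth,
      fun s hs h => hF.eq s (hV hs) h⟩⟩

/-- `(P, B, D, S)` is Poisson reducible: the prescription `{f, h}_V (π m) = {F, H}_B (m)`, for
all `m ∈ π⁻¹(V)` and all local `D`-invariant extensions `F`, `H` of `f ∘ π`, `h ∘ π` at `m`, gives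
a well-defined structure of presheaf of Poisson algebras on `C^∞_{S/D_S}`. -/
def IsPoissonReducible (B : PoissonTensor J P) (ι : S → P)
    (D : ∀ s : S, Submodule ℝ (TangentSpace J (ι s))) : Prop :=
  ∃ br : ∀ V : Opens (LeafSpace (tangentPart (E' := E') ι D)),
      leafFunctions (E' := E') ι D V →ₗ[ℝ] leafFunctions (E' := E') ι D V →ₗ[ℝ]
        leafFunctions (E' := E') ι D V,
    -- the bracket is given by the bracket of local `D`-invariant extensions
    (∀ V (f h : leafFunctions (E' := E') ι D V) (m : S)
      (hm : leafProj (tangentPart (E' := E') ι D) m ∈ V) (U : Set P) (F H : P → ℝ),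
      IsInvariantExtension ι D V f.1 m U F → IsInvariantExtension ι D V h.1 m U H →
      (br V f h).1 ⟨_, hm⟩ = B.bracket F H (ι m)) ∧
    -- each `C^∞_{S/D_S}(V)` is a Poisson algebra
    (∀ V (f : leafFunctions (E' := E') ι D V), br V f f = 0) ∧
    (∀ V (f g h : leafFunctions (E' := E') ι D V),
      br V f (br V g h) + br V g (br V h f) + br V h (br V f g) = 0) ∧
    (∀ V (f g h : leafFunctions (E' := E') ι D V), br V f (g * h) = br V f g * h + g * br V f h) ∧
    -- the restriction maps preserve the brackets
    (∀ V V' (hV : V' ≤ V) (f h : leafFunctions (E' := E') ι D V),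
      leafRestrict ι D hV (br V f h) = br V' (leafRestrict ι D hV f) (leafRestrict ι D hV h))

/-- `Δ_z`: the differentials at `z` of smooth functions, defined on an open neighbourhood `U` of
`z` in `P`, whose differentials vanish on `D` at the points of `U ∩ S`. -/
def deltaAt (ι : S → P) (D : ∀ s : S, Submodule ℝ (TangentSpace J (ι s))) (z : S) :
    Set (TangentSpace J (ι z) →L[ℝ] ℝ) :=
  {α | ∃ (U : Set P) (f : P → ℝ), IsOpen U ∧ ι z ∈ U ∧ ContMDiffOn J 𝓘(ℝ, ℝ) ∞ f U ∧
    KillsOn ι D f U ∧ mvfderiv J f (ι z) = α}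

/-- `(Δ_z)_S`: the elements of `Δ_z` that come from functions constant on `U ∩ S`. -/
def deltaConstAt (ι : S → P) (D : ∀ s : S, Submodule ℝ (TangentSpace J (ι s))) (z : S) :
    Set (TangentSpace J (ι z) →L[ℝ] ℝ) :=
  {α | ∃ (U : Set P) (f : P → ℝ), IsOpen U ∧ ι z ∈ U ∧ ContMDiffOn J 𝓘(ℝ, ℝ) ∞ f U ∧
    KillsOn ι D f U ∧ (∃ c : ℝ, ∀ s, ι s ∈ U → f (ι s) = c) ∧ mvfderiv J f (ι z) = α}

/-- The annihilator `A° ⊂ T_x P` of a set `A` of covectors at `x`. -/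
def annihilator {x : P} (A : Set (TangentSpace J x →L[ℝ] ℝ)) : Set (TangentSpace J x) :=
  {v | ∀ α ∈ A, α v = 0}

end Reduction

/-! ### Controlled Hamiltonian systems on a cotangent bundle -/

section CH

variable {E : Type*} [NormedAddCommGroup E] [NormedSpace ℝ E]
  {Q : Type*} [TopologicalSpace Q] [ChartedSpace E Q]

/-- The fibre `T*_x Q`. -/
abbrev CotangentFiber (E : Type*) [NormedAddCommGroup E] [NormedSpace ℝ E]
    {Q : Type*} [TopologicalSpace Q] [ChartedSpace E Q] (x : Q) : Type _ :=
  TangentSpace 𝓘(ℝ, E) x →L[ℝ] Bundle.Trivial Q ℝ x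

/-- The cotangent bundle `T*Q`. -/
abbrev Cotangent (E : Type*) [NormedAddCommGroup E] [NormedSpace ℝ E]
    (Q : Type*) [TopologicalSpace Q] [ChartedSpace E Q] [IsManifold 𝓘(ℝ, E) ∞ Q] : Type _ :=
  Bundle.TotalSpace (E →L[ℝ] ℝ) (fun x : Q => CotangentFiber E x)

/-- The model with corners of `T*Q`. -/
abbrev cotModel (E : Type*) [NormedAddCommGroup E] [NormedSpace ℝ E] :
    ModelWithCorners ℝ (E × (E →L[ℝ] ℝ)) (ModelProd E (E →L[ℝ] ℝ)) :=
  𝓘(ℝ, E).prod 𝓘(ℝ, E →L[ℝ] ℝ)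

variable [IsManifold 𝓘(ℝ, E) ∞ Q]

/-- The vertical lift of `η ∈ T*_x Q` at `α ∈ T*_x Q`: the velocity of `s ↦ α + s η` at `s = 0`. -/
def verticalLift (α : Cotangent E Q) (η : CotangentFiber E α.1) :
    TangentSpace (cotModel E) α :=
  mfderiv 𝓘(ℝ, ℝ) (cotModel E)
    (fun s : ℝ => (⟨α.1, α.2 + s • η⟩ : Cotangent E Q)) 0 (1 : ℝ)

/-- A (smooth) splitting of `T T*Q` into the vertical bundle and a horizontal bundle, given by the
map that sends a tangent vector to its vertical part, each vertical space being identified with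
the fibre of `T*Q`. The horizontal bundle is the kernel. -/
structure HorizontalSplitting (E : Type*) [NormedAddCommGroup E] [NormedSpace ℝ E]
    (Q : Type*) [TopologicalSpace Q] [ChartedSpace E Q] [IsManifold 𝓘(ℝ, E) ∞ Q] where
  vert : ∀ α : Cotangent E Q, TangentSpace (cotModel E) α →ₗ[ℝ] CotangentFiber E α.1
  vert_verticalLift : ∀ (α : Cotangent E Q) (η : CotangentFiber E α.1),
    vert α (verticalLift α η) = η
  smooth : ContMDiff (cotModel E).tangent (cotModel E) ∞
    (fun v : TangentBundle (cotModel E) (Cotangent E Q) =>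
      (⟨v.1.1, vert v.1 v.2⟩ : Cotangent E Q))

/-- A smooth fibre-preserving map `T*Q → T*Q`. -/
structure FiberMap (E : Type*) [NormedAddCommGroup E] [NormedSpace ℝ E]
    (Q : Type*) [TopologicalSpace Q] [ChartedSpace E Q] [IsManifold 𝓘(ℝ, E) ∞ Q] where
  onFiber : ∀ x : Q, CotangentFiber E x → CotangentFiber E x
  smooth : ContMDiff (cotModel E) (cotModel E) ∞
    (fun α : Cotangent E Q => (⟨α.1, onFiber α.1 α.2⟩ : Cotangent E Q))

/-- The underlying map of total spaces. -/
def FiberMap.toMap (φ : FiberMap E Q) (α : Cotangent E Q) : Cotangent E Q :=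
  ⟨α.1, φ.onFiber α.1 α.2⟩

/-- `vlift(φ) X (α)`: the vertical part of `Tφ (X α)`, translated from `φ α` to `α` along their
common fibre. -/
def FiberMap.vlift (K : HorizontalSplitting E Q) (φ : FiberMap E Q)
    (X : ∀ α : Cotangent E Q, TangentSpace (cotModel E) α) (α : Cotangent E Q) :
    TangentSpace (cotModel E) α :=
  verticalLift α (K.vert (φ.toMap α) (mfderiv (cotModel E) (cotModel E) φ.toMap α (X α)))

/-- A controlled Hamiltonian system `(T*Q, B, H, F, W)`; the control subset `W` is given by its
inclusion `ι`, and is an embedded submanifold fibred over `Q`. -/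
structure CHSystem (E : Type*) [NormedAddCommGroup E] [NormedSpace ℝ E]
    (Q : Type*) [TopologicalSpace Q] [ChartedSpace E Q] [IsManifold 𝓘(ℝ, E) ∞ Q]
    (E' : Type*) [NormedAddCommGroup E'] [NormedSpace ℝ E']
    (W : Type*) [TopologicalSpace W] [ChartedSpace E' W] [IsManifold 𝓘(ℝ, E') ∞ W] where
  /-- The Poisson tensor `B`. -/
  B : PoissonTensor (cotModel E) (Cotangent E Q)
  /-- The Hamiltonian `H`. -/
  H : Cotangent E Q → ℝ
  smooth_H : ContMDiff (cotModel E) 𝓘(ℝ, ℝ) ∞ H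
  /-- The force map `F`. -/
  F : FiberMap E Q
  /-- The inclusion of the control subset `W`. -/
  ι : W → Cotangent E Q
  submanifold : IsEmbeddedSubmanifold (E' := E') (cotModel E) ι
  surjective : Function.Surjective (fun w => (ι w).1)
  submersion : ∀ w, Function.Surjective (mfderiv 𝓘(ℝ, E') 𝓘(ℝ, E) (fun w => (ι w).1) w)

variable {E' W : Type*} [NormedAddCommGroup E'] [NormedSpace ℝ E']
  [TopologicalSpace W] [ChartedSpace E' W] [IsManifold 𝓘(ℝ, E') ∞ W]

/-- A control law `u : T*Q → W`, a smooth fibre-preserving map with values in `W`. -/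
def CHSystem.ControlLaw (C : CHSystem E Q E' W) : Type _ :=
  {u : FiberMap E Q // ∀ α, u.toMap α ∈ range C.ι}

/-- The Hamiltonian vector field `X_H = B♯ dH`. -/
def CHSystem.hamiltonianField (C : CHSystem E Q E' W) (α : Cotangent E Q) :
    TangentSpace (cotModel E) α :=
  C.B.sharp α (mvfderiv (cotModel E) C.H α)

/-- The dynamical vector field `X_H + vlift(F) X_H + vlift(u) X_H` of the closed-loop system. -/
def CHSystem.dynamicalField (C : CHSystem E Q E' W) (K : HorizontalSplitting E Q)
    (u : C.ControlLaw) (α : Cotangent E Q) : TangentSpace (cotModel E) α :=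
  C.hamiltonianField α + C.F.vlift K C.hamiltonianField α +
    u.1.vlift K C.hamiltonianField α

/-- `W` is a controllability submanifold: any two states are joined by a curve on `[0, 1]` made of
finitely many pieces, each an integral curve of the dynamical vector field of some control law with
values in `W`. (Only a condition when there are control laws at all. If the dynamical vector field
of each single control law joins any two states, then this holds.) -/
def CHSystem.IsControllabilitySubmanifold (C : CHSystem E Q E' W)
    (K : HorizontalSplitting E Q) : Prop :=
  Nonempty C.ControlLaw → ∀ x₀ x₁ : Cotangent E Q,
    ∃ (n : ℕ) (t : ℕ → ℝ) (u : ℕ → C.ControlLaw) (γ : ℝ → Cotangent E Q),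
      t 0 = 0 ∧ t n = 1 ∧ (∀ i < n, t i < t (i + 1)) ∧
      (∀ i < n, IsMIntegralCurveOn (I := cotModel E) γ (C.dynamicalField K (u i))
        (Icc (t i) (t (i + 1)))) ∧
      γ 0 = x₀ ∧ γ 1 = x₁

/-- `D ⊂ T T*Q|_W` is a controllability distribution: it is a Poisson integrable generalized
distribution along the controllability submanifold `W`. -/
structure CHSystem.IsControllabilityDistribution (C : CHSystem E Q E' W)
    (K : HorizontalSplitting E Q)
    (D : ∀ w : W, Submodule ℝ (TangentSpace (cotModel E) (C.ι w))) : Prop where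
  controllable : C.IsControllabilitySubmanifold K
  poisson : IsPoissonDistribution C.B C.ι D
  smooth : IsSmoothDistribution (tangentPart (E' := E') C.ι D)
  integrable : IsIntegrableDistribution (tangentPart (E' := E') C.ι D)

/-- The CH system is Poisson reducible by `D`. -/
def CHSystem.IsPoissonReducibleBy (C : CHSystem E Q E' W)
    (D : ∀ w : W, Submodule ℝ (TangentSpace (cotModel E) (C.ι w))) : Prop :=
  IsPoissonReducible (E' := E') C.B C.ι D

end CH

end

end PoissonReduction

open PoissonReduction

/-!
The brackets of `D`-invariant extensions descend to the leaf space exactly when they do not depend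
on the extensions, that is, when `{f, k} = 0` on `S` for `f` and `k` `D`-invariant and `k`
vanishing on `S`; in terms of differentials this is `B♯(Δ_z) ⊂ (Δ_z)_S°`. Given this, `{f, g}` is
again `D`-invariant because `D` is Poisson, so it is constant along the leaves, and the algebraic
identities are inherited from `B`.

Conversely, at a point where `D z ≠ 0` the condition holds because `D` is Poisson: for any smooth
`a` the product `a * k` is `D`-invariant too, and differentiating
`{f, a * k} = {f, a} * k + a * {f, k}` along `v ∈ D z` gives `da(v) * {f, k}(z) = 0`. It passes to
limits of such points by continuity. Near any other point `D = 0`, the leaves are points and every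
smooth function is a `D`-invariant extension of a function on the leaf space, so that reducibility
gives `{f, k}(z) = {f, 0}(z) = 0`.
-/

namespace PoissonReduction

section Calculus

variable {EP HP P : Type*} [NormedAddCommGroup EP] [NormedSpace ℝ EP]
  [TopologicalSpace HP] {J : ModelWithCorners ℝ EP HP}
  [TopologicalSpace P] [ChartedSpace HP P]

theorem mdifferentiableAt_of_contMDiffOn {F H' N : Type*} [NormedAddCommGroup F]
    [NormedSpace ℝ F] [TopologicalSpace H'] {I' : ModelWithCorners ℝ F H'} [TopologicalSpace N]
    [ChartedSpace H' N] {f : P → N} {U : Set P} {x : P} (hU : IsOpen U)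
    (hf : ContMDiffOn J I' ∞ f U) (hx : x ∈ U) : MDifferentiableAt J I' f x :=
  (hf.contMDiffAt (hU.mem_nhds hx)).mdifferentiableAt (by simp)

theorem mvfderiv_const_smul {F : Type*} [NormedAddCommGroup F] [NormedSpace ℝ F] {f : P → F}
    {x : P} (c : ℝ) (hf : MDifferentiableAt J 𝓘(ℝ, F) f x) :
    mvfderiv J (c • f) x = c • mvfderiv J f x :=
  const_smul_mfderiv hf c

theorem exists_contMDiffOn_mvfderiv_ne_zero [IsManifold J ∞ P] (x : P)
    {v : TangentSpace J x} (hv : v ≠ 0) :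
    ∃ (O : Set P) (a : P → ℝ), IsOpen O ∧ x ∈ O ∧ ContMDiffOn J 𝓘(ℝ, ℝ) ∞ a O ∧
      mvfderiv J a x v ≠ 0 := by
  have hinv := isInvertible_mfderiv_extChartAt (I := J) (mem_extChartAt_source (I := J) x)
  set w : EP := mfderiv J 𝓘(ℝ, EP) (extChartAt J x) x v
  have hw0 : w ≠ 0 := fun h => hv (hinv.injective (by rw [map_zero]; exact h))
  obtain ⟨ℓ, hℓ⟩ := SeparatingDual.exists_ne_zero (R := ℝ) hw0
  refine ⟨(chartAt HP x).source, ℓ ∘ extChartAt J x, (chartAt HP x).open_source,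
    mem_chart_source HP x, ℓ.contMDiff.comp_contMDiffOn contMDiffOn_extChartAt, ?_⟩
  have hℓ' : mvfderiv 𝓘(ℝ, EP) ℓ (extChartAt J x x) = ℓ := ℓ.mfderiv_eq
  rwa [mvfderiv_comp_apply (I' := J) x ℓ.mdifferentiableAt
    (mdifferentiableAt_extChartAt (mem_chart_source HP x)), hℓ']

namespace PoissonTensor

variable (B : PoissonTensor J P) {f g h : P → ℝ} {x : P}

theorem bracket_antisymm (f g : P → ℝ) (x : P) : B.bracket f g x = -B.bracket g f x :=
  B.antisymm x _ _

theorem bracket_self (f : P → ℝ) (x : P) : B.bracket f f x = 0 :=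
  self_eq_neg.1 (B.bracket_antisymm f f x)

theorem bracket_add_right (f : P → ℝ) (hg : MDifferentiableAt J 𝓘(ℝ, ℝ) g x)
    (hh : MDifferentiableAt J 𝓘(ℝ, ℝ) h x) :
    B.bracket f (g + h) x = B.bracket f g x + B.bracket f h x := by
  simp only [bracket, mvfderiv_add hg hh, map_add]

theorem bracket_sub_right (f : P → ℝ) (hg : MDifferentiableAt J 𝓘(ℝ, ℝ) g x)
    (hh : MDifferentiableAt J 𝓘(ℝ, ℝ) h x) :
    B.bracket f (g - h) x = B.bracket f g x - B.bracket f h x := by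
  simp only [bracket, mvfderiv_sub hg hh, map_sub]

theorem bracket_smul_right (c : ℝ) (f : P → ℝ) (hg : MDifferentiableAt J 𝓘(ℝ, ℝ) g x) :
    B.bracket f (c • g) x = c * B.bracket f g x := by
  simp only [bracket, mvfderiv_const_smul c hg, map_smul, smul_eq_mul]

theorem bracket_mul_right (f : P → ℝ) (hg : MDifferentiableAt J 𝓘(ℝ, ℝ) g x)
    (hh : MDifferentiableAt J 𝓘(ℝ, ℝ) h x) :
    B.bracket f (g * h) x = B.bracket f g x * h x + g x * B.bracket f h x := by
  simp only [bracket, mvfderiv_mul hg hh, map_add, map_smul, smul_eq_mul]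
  ring

theorem bracket_zero_right (f : P → ℝ) (x : P) : B.bracket f 0 x = 0 := by
  simp only [bracket, mvfderiv_zero, map_zero]

theorem bracket_jacobi {U : Set P} (hU : IsOpen U) (hf : ContMDiffOn J 𝓘(ℝ, ℝ) ∞ f U)
    (hg : ContMDiffOn J 𝓘(ℝ, ℝ) ∞ g U) (hh : ContMDiffOn J 𝓘(ℝ, ℝ) ∞ h U) (hx : x ∈ U) :
    B.bracket f (B.bracket g h) x + B.bracket g (B.bracket h f) x +
      B.bracket h (B.bracket f g) x = 0 :=
  B.jacobi U hU f g h hf hg hh x hx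

end PoissonTensor

end Calculus

section IntegralCurves

variable {E H M : Type*} [NormedAddCommGroup E] [NormedSpace ℝ E] [TopologicalSpace H]
  {I : ModelWithCorners ℝ E H} [TopologicalSpace M] [ChartedSpace H M]
  {γ : ℝ → M} {X : ∀ x : M, TangentSpace I x} {a b : ℝ}

theorem apply_eq_of_isMIntegralCurveOn {F : Type*} [NormedAddCommGroup F] [NormedSpace ℝ F]
    {K : M → F} (hab : a ≤ b) (hγ : IsMIntegralCurveOn (I := I) γ X (Icc a b))
    (hK : ∀ t ∈ Icc a b, MDifferentiableAt I 𝓘(ℝ, F) K (γ t))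
    (hK₀ : ∀ t ∈ Icc a b, mvfderiv I K (γ t) (X (γ t)) = 0) : K (γ b) = K (γ a) := by
  have hderiv : ∀ t ∈ Icc a b, HasDerivWithinAt (K ∘ γ) 0 (Icc a b) t := by
    intro t ht
    have h := (hK t ht).hasMFDerivAt.comp_hasMFDerivWithinAt t (hγ t ht)
    have hzero : (mfderiv I 𝓘(ℝ, F) K (γ t)).comp
        ((1 : ℝ →L[ℝ] ℝ).smulRight (X (γ t))) = (0 : ℝ →L[ℝ] F) := by
      ext
      change mvfderiv I K (γ t) ((1 : ℝ) • X (γ t)) = 0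
      rw [one_smul, hK₀ t ht]
    have h' : HasFDerivWithinAt (K ∘ γ) (0 : ℝ →L[ℝ] F) (Icc a b) t :=
      (h.congr_mfderiv hzero).hasFDerivWithinAt
    simpa only [zero_apply] using h'.hasDerivWithinAt
  refine constant_of_has_deriv_right_zero (f := K ∘ γ)
    (fun t ht => (hderiv t ht).continuousWithinAt) (fun t ht => ?_) b ⟨hab, le_rfl⟩
  exact (hderiv t (Ico_subset_Icc_self ht)).mono_of_mem_nhdsWithin
    (Icc_mem_nhdsGE_of_mem ht)

theorem eq_of_isMIntegralCurveOn_of_eventually_eq_zero [IsManifold I 1 M] (hab : a ≤ b)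
    (hγ : IsMIntegralCurveOn (I := I) γ X (Icc a b)) (hX : ∀ᶠ y in 𝓝 (γ a), X y = 0) :
    γ b = γ a := by
  have : T1Space M := I.t1Space M
  have hcont : ContinuousOn γ (Icc a b) := fun t ht => (hγ t ht).continuousWithinAt
  have hclosed : IsClosed ({t | γ t = γ a} ∩ Icc a b) := by
    rw [inter_comm]
    exact hcont.preimage_isClosed_of_isClosed isClosed_Icc isClosed_singleton
  refine hclosed.Icc_subset_of_forall_mem_nhdsWithin rfl ?_ (right_mem_Icc.2 hab)
  rintro t ⟨hta : γ t = γ a, ht⟩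
  have hnear : ∀ᶠ s in 𝓝[≥] t, X (γ s) = 0 ∧ γ s ∈ (chartAt H (γ a)).source ∧ s ∈ Icc a b := by
    have hγt : Filter.Tendsto γ (𝓝[≥] t) (𝓝 (γ a)) := hta ▸
      ((hcont t (Ico_subset_Icc_self ht)).mono_of_mem_nhdsWithin
        (Icc_mem_nhdsGE_of_mem ht)).tendsto
    filter_upwards [hγt.eventually hX, hγt.eventually (chart_source_mem_nhds H (γ a)),
      Icc_mem_nhdsGE_of_mem ht] with s hXs hs hsI using ⟨hXs, hs, hsI⟩
  obtain ⟨u, htu, hu⟩ := mem_nhdsGE_iff_exists_Icc_subset.1 hnear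
  filter_upwards [Ioc_mem_nhdsGT htu] with s hs
  have hsub : Icc t s ⊆ Icc t u := Icc_subset_Icc_right hs.2
  have hchart : extChartAt I (γ a) (γ s) = extChartAt I (γ a) (γ t) :=
    apply_eq_of_isMIntegralCurveOn hs.1.le (hγ.mono fun r hr => (hu (hsub hr)).2.2)
      (fun r hr => mdifferentiableAt_extChartAt (hu (hsub hr)).2.1)
      (fun r hr => by rw [(hu (hsub hr)).1, map_zero])
  have hsrc : ∀ r ∈ Icc t u, γ r ∈ (extChartAt I (γ a)).source := fun r hr => by
    rw [extChartAt_source]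
    exact (hu hr).2.1
  exact ((extChartAt I (γ a)).injOn (hsrc s ⟨hs.1.le, hs.2⟩)
    (hsrc t ⟨le_rfl, htu.le⟩) hchart).trans hta

end IntegralCurves

section Leaves

variable {E' S : Type*} [NormedAddCommGroup E'] [NormedSpace ℝ E']
  [TopologicalSpace S] [ChartedSpace E' S] [IsManifold 𝓘(ℝ, E') ∞ S]
  {Δ : ∀ y : S, Submodule ℝ (TangentSpace 𝓘(ℝ, E') y)} {x : S} {A : Set S}

theorem isInvariantSet_preimage_leafProj (V : Set (LeafSpace Δ)) :
    IsInvariantSet Δ (leafProj Δ ⁻¹' V) := by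
  intro x y hxy hx
  have h : leafProj Δ x = leafProj Δ y := Quotient.sound (Relation.EqvGen.rel _ _ hxy)
  rwa [mem_preimage, ← h]

theorem IsInvariantSet.inter {A' : Set S} (hA : IsInvariantSet Δ A) (hA' : IsInvariantSet Δ A') :
    IsInvariantSet Δ (A ∩ A') :=
  fun x y h hx => ⟨hA x y h hx.1, hA' x y h hx.2⟩

theorem flowStep_of_isMIntegralCurveOn {O : Set S} {X : ∀ y : S, TangentSpace 𝓘(ℝ, E') y}
    {γ : ℝ → S} {a b t : ℝ} (hX : IsLocalSection Δ O X)
    (hγ : IsMIntegralCurveOn (I := 𝓘(ℝ, E')) γ X (Icc a b)) (hO : MapsTo γ (Icc a b) O)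
    (ht : t ∈ Icc a b) : FlowStep Δ (γ a) (γ t) :=
  ⟨O, X, γ, a, t, hX, ht.1, hγ.mono (Icc_subset_Icc_right ht.2),
    hO.mono_left (Icc_subset_Icc_right ht.2), rfl, rfl⟩

theorem isInvariantSet_singleton (hx : ∀ᶠ y in 𝓝 x, Δ y = ⊥) : IsInvariantSet Δ {x} := by
  rintro _ _ ⟨O, X, γ, a, b, hX, hab, hγ, hO, rfl, rfl⟩ (rfl : γ a = x)
  refine eq_of_isMIntegralCurveOn_of_eventually_eq_zero hab hγ ?_
  filter_upwards [hx, hX.isOpen.mem_nhds (hO (left_mem_Icc.2 hab))] with y hy hyO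
  exact (Submodule.mem_bot ℝ).1 (hy ▸ hX.mem y hyO)

theorem leafProj_out_of_eventually_eq_bot (hx : ∀ᶠ y in 𝓝 x, Δ y = ⊥) :
    (leafProj Δ x).out = x :=
  ((isInvariantSet_singleton hx).mem_iff (Quotient.out_eq (leafProj Δ x))).2 rfl

theorem preimage_image_leafProj_of_eq_bot (hA : IsOpen A) (hbot : ∀ y ∈ A, Δ y = ⊥) :
    leafProj Δ ⁻¹' (leafProj Δ '' A) = A := by
  refine Subset.antisymm ?_ (subset_preimage_image _ _)
  rintro y ⟨x, hx, hxy⟩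
  have hinv : IsInvariantSet Δ {x} :=
    isInvariantSet_singleton (Filter.mem_of_superset (hA.mem_nhds hx) hbot)
  rwa [show y = x from (hinv.mem_iff hxy).1 rfl]

theorem isOpen_image_leafProj_of_eq_bot (hA : IsOpen A) (hbot : ∀ y ∈ A, Δ y = ⊥) :
    IsOpen (leafProj Δ '' A) := by
  refine (isQuotientMap_quotient_mk' (s := leafSetoid Δ)).isOpen_preimage.1 ?_
  exact (preimage_image_leafProj_of_eq_bot hA hbot).symm ▸ hA

end Leaves

section InvariantFunctions

variable {EP HP P : Type*} [NormedAddCommGroup EP] [NormedSpace ℝ EP]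
  [TopologicalSpace HP] {J : ModelWithCorners ℝ EP HP}
  [TopologicalSpace P] [ChartedSpace HP P]
  {S : Type*} {ι : S → P} {D : ∀ s : S, Submodule ℝ (TangentSpace J (ι s))}

/-- A `D`-invariant function on the open set `U`: a smooth function whose differential vanishes on
`D` at the points of `S ∩ U`. The elements of `deltaAt` are the differentials of such functions. -/
structure IsInvariantOn (ι : S → P) (D : ∀ s : S, Submodule ℝ (TangentSpace J (ι s)))
    (f : P → ℝ) (U : Set P) : Prop where
  isOpen : IsOpen U
  smooth : ContMDiffOn J 𝓘(ℝ, ℝ) ∞ f U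
  kills : KillsOn ι D f U

variable {U U' : Set P} {f g k a : P → ℝ} {B : PoissonTensor J P} {z : S}

namespace IsInvariantOn

theorem mdifferentiableAt (hf : IsInvariantOn ι D f U) {x : P} (hx : x ∈ U) :
    MDifferentiableAt J 𝓘(ℝ, ℝ) f x :=
  mdifferentiableAt_of_contMDiffOn hf.isOpen hf.smooth hx

theorem mono (hf : IsInvariantOn ι D f U) (hU' : IsOpen U') (h : U' ⊆ U) :
    IsInvariantOn ι D f U' :=
  ⟨hU', hf.smooth.mono h, fun s hs => hf.kills s (h hs)⟩

theorem const (c : ℝ) (hU : IsOpen U) : IsInvariantOn ι D (fun _ => c) U :=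
  ⟨hU, contMDiffOn_const, fun s _ v _ => by rw [mvfderiv_const, zero_apply]⟩

theorem sub (hf : IsInvariantOn ι D f U) (hg : IsInvariantOn ι D g U) :
    IsInvariantOn ι D (f - g) U where
  isOpen := hf.isOpen
  smooth := hf.smooth.sub hg.smooth
  kills s hs v hv := by
    rw [mvfderiv_sub (hf.mdifferentiableAt hs) (hg.mdifferentiableAt hs), sub_apply,
      hf.kills s hs v hv, hg.kills s hs v hv, sub_zero]

theorem bracket (hD : IsPoissonDistribution B ι D) (hf : IsInvariantOn ι D f U)
    (hg : IsInvariantOn ι D g U) : IsInvariantOn ι D (B.bracket f g) U :=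
  ⟨hf.isOpen, B.smooth U hf.isOpen f g hf.smooth hg.smooth,
    hD U hf.isOpen f g hf.smooth hg.smooth hf.kills hg.kills⟩

theorem mul_of_eq_zero (ha : ContMDiffOn J 𝓘(ℝ, ℝ) ∞ a U) (hk : IsInvariantOn ι D k U)
    (hk₀ : ∀ s, ι s ∈ U → k (ι s) = 0) : IsInvariantOn ι D (a * k) U where
  isOpen := hk.isOpen
  smooth := ha.mul hk.smooth
  kills s hs v hv := by
    rw [mvfderiv_mul (mdifferentiableAt_of_contMDiffOn hk.isOpen ha hs) (hk.mdifferentiableAt hs),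
      add_apply, smul_apply, smul_apply, hk.kills s hs v hv, hk₀ s hs, smul_zero, zero_smul,
      add_zero]

end IsInvariantOn

theorem mem_deltaAt {α : TangentSpace J (ι z) →L[ℝ] ℝ} :
    α ∈ deltaAt ι D z ↔ ∃ U f, IsInvariantOn ι D f U ∧ ι z ∈ U ∧ mvfderiv J f (ι z) = α :=
  ⟨fun ⟨U, f, hU, hz, hf, hkill, h⟩ => ⟨U, f, ⟨hU, hf, hkill⟩, hz, h⟩,
    fun ⟨U, f, hf, hz, h⟩ => ⟨U, f, hf.isOpen, hz, hf.smooth, hf.kills, h⟩⟩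

theorem mem_deltaConstAt {α : TangentSpace J (ι z) →L[ℝ] ℝ} :
    α ∈ deltaConstAt ι D z ↔ ∃ U k, IsInvariantOn ι D k U ∧ (∀ s, ι s ∈ U → k (ι s) = 0) ∧
      ι z ∈ U ∧ mvfderiv J k (ι z) = α := by
  constructor
  · rintro ⟨U, f, hU, hz, hf, hkill, ⟨c, hc⟩, rfl⟩
    have hfU : IsInvariantOn ι D f U := ⟨hU, hf, hkill⟩
    refine ⟨U, f - fun _ => c, hfU.sub (.const c hU), fun s hs => sub_eq_zero.2 (hc s hs), hz, ?_⟩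
    rw [mvfderiv_sub (hfU.mdifferentiableAt hz) mdifferentiableAt_const, mvfderiv_const, sub_zero]
  · rintro ⟨U, k, hk, hk₀, hz, rfl⟩
    exact ⟨U, k, hk.isOpen, hz, hk.smooth, hk.kills, ⟨0, hk₀⟩, rfl⟩

/-- The condition `B♯(Δ_z) ⊂ (Δ_z)_S°` in terms of brackets: near `z`, a `D`-invariant function
and a `D`-invariant function vanishing on `S` have bracket zero at `z`. -/
def BracketVanishesAt (B : PoissonTensor J P) (ι : S → P)
    (D : ∀ s : S, Submodule ℝ (TangentSpace J (ι s))) (z : S) : Prop :=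
  ∀ U f k, IsInvariantOn ι D f U → IsInvariantOn ι D k U → (∀ s, ι s ∈ U → k (ι s) = 0) →
    ι z ∈ U → B.bracket f k (ι z) = 0

theorem sharp_image_deltaAt_subset_annihilator_iff :
    B.sharp (ι z) '' deltaAt ι D z ⊆ annihilator (deltaConstAt ι D z) ↔
      BracketVanishesAt B ι D z := by
  constructor
  · intro h U f k hf hk hk₀ hz
    rw [B.bracket_antisymm, neg_eq_zero]
    exact h (mem_image_of_mem _ (mem_deltaAt.2 ⟨U, f, hf, hz, rfl⟩)) _
      (mem_deltaConstAt.2 ⟨U, k, hk, hk₀, hz, rfl⟩)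
  · rintro h _ ⟨α, hα, rfl⟩ β hβ
    obtain ⟨U, f, hf, hz, rfl⟩ := mem_deltaAt.1 hα
    obtain ⟨U', k, hk, hk₀, hz', rfl⟩ := mem_deltaConstAt.1 hβ
    have hUU' : IsOpen (U ∩ U') := hf.isOpen.inter hk.isOpen
    have hfk := h (U ∩ U') f k (hf.mono hUU' inter_subset_left) (hk.mono hUU' inter_subset_right)
      (fun s hs => hk₀ s hs.2) ⟨hz, hz'⟩
    rwa [B.bracket_antisymm, neg_eq_zero] at hfk

variable {E' : Type*} [NormedAddCommGroup E'] [NormedSpace ℝ E']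
  [TopologicalSpace S] [ChartedSpace E' S]

theorem tangentPart_eq_bot (hι : IsEmbeddedSubmanifold (E' := E') J ι) (hz : D z = ⊥) :
    tangentPart (E' := E') ι D z = ⊥ := by
  rw [tangentPart, hz]
  exact LinearMap.ker_eq_bot.2 (hι.immersion z)

theorem IsInvariantOn.apply_eq_of_leafProj_eq [IsManifold 𝓘(ℝ, E') ∞ S]
    (hι : ContMDiff 𝓘(ℝ, E') J ∞ ι) (hf : IsInvariantOn ι D f U)
    (hU : IsInvariantSet (tangentPart (E' := E') ι D) (ι ⁻¹' U)) {m m' : S} (hm : ι m ∈ U)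
    (h : leafProj (tangentPart (E' := E') ι D) m = leafProj (tangentPart (E' := E') ι D) m') :
    f (ι m') = f (ι m) := by
  have hlevel : IsInvariantSet (tangentPart (E' := E') ι D) {s | ι s ∈ U ∧ f (ι s) = f (ι m)} := by
    rintro _ _ ⟨O, X, γ, a, b, hX, hab, hγ, hO, rfl, rfl⟩ ⟨haU, ha⟩
    have hγU : ∀ t ∈ Icc a b, ι (γ t) ∈ U := fun t ht =>
      hU _ _ (flowStep_of_isMIntegralCurveOn hX hγ hO ht) haU
    have hιd : ∀ s, MDifferentiableAt 𝓘(ℝ, E') J ι s := fun s =>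
      hι.contMDiffAt.mdifferentiableAt (by simp)
    have hfd : ∀ t ∈ Icc a b, MDifferentiableAt J 𝓘(ℝ, ℝ) f (ι (γ t)) := fun t ht =>
      hf.mdifferentiableAt (hγU t ht)
    have hderiv : ∀ t ∈ Icc a b, mvfderiv 𝓘(ℝ, E') (f ∘ ι) (γ t) (X (γ t)) = 0 := fun t ht => by
      rw [mvfderiv_comp_apply (γ t) (hfd t ht) (hιd (γ t))]
      exact hf.kills (γ t) (hγU t ht) _ (hX.mem (γ t) (hO ht))
    exact ⟨hγU b ⟨hab, le_rfl⟩, (apply_eq_of_isMIntegralCurveOn (K := f ∘ ι) hab hγ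
      (fun t ht => (hfd t ht).comp (γ t) (hιd (γ t))) hderiv).trans ha⟩
  exact ((hlevel.mem_iff h).1 ⟨hm, rfl⟩).2

end InvariantFunctions

section ReducedBracket

variable {EP HP P : Type*} [NormedAddCommGroup EP] [NormedSpace ℝ EP]
  [TopologicalSpace HP] {J : ModelWithCorners ℝ EP HP}
  [TopologicalSpace P] [ChartedSpace HP P]
  {E' S : Type*} [NormedAddCommGroup E'] [NormedSpace ℝ E']
  [TopologicalSpace S] [ChartedSpace E' S] [IsManifold 𝓘(ℝ, E') ∞ S]
  {ι : S → P} {D : ∀ s : S, Submodule ℝ (TangentSpace J (ι s))}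

local notation "π_D" => leafProj (tangentPart (E' := E') ι D)

theorem exists_isOpen_preimage_eq_preimage_leafProj (hι : IsInducing ι)
    (V : Opens (LeafSpace (tangentPart (E' := E') ι D))) :
    ∃ O : Set P, IsOpen O ∧ ι ⁻¹' O = π_D ⁻¹' V :=
  hι.isOpen_iff.1 (V.isOpen.preimage continuous_quotient_mk')

variable {V : Opens (LeafSpace (tangentPart (E' := E') ι D))} {m m' : S} {U U' O : Set P}

namespace IsInvariantExtension

variable {f g : V → ℝ} {F G : P → ℝ}

theorem at_point (hF : IsInvariantExtension ι D V f m U F) (h : ι m' ∈ U) :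
    IsInvariantExtension ι D V f m' U F :=
  ⟨⟨hF.isOpen, h, hF.invariant, hF.smooth, hF.eq⟩, hF.kills⟩

theorem at_leaf (hF : IsInvariantExtension ι D V f m U F) (h : π_D m = π_D m') :
    IsInvariantExtension ι D V f m' U F :=
  hF.at_point ((hF.invariant.mem_iff h).1 hF.mem)

theorem inter (hF : IsInvariantExtension ι D V f m U F)
    (hG : IsInvariantExtension ι D V g m U' G) :
    IsInvariantExtension ι D V f m (U ∩ U') F ∧ IsInvariantExtension ι D V g m (U ∩ U') G :=
  have h := hF.toIsLocalExtension.inter hG.toIsLocalExtension rfl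
  ⟨⟨h.1, fun s hs hU => hF.kills s hs hU.1⟩, ⟨h.2, fun s hs hU => hG.kills s hs hU.2⟩⟩

theorem mono {V' : Opens (LeafSpace (tangentPart (E' := E') ι D))} (hV : V' ≤ V)
    (hF : IsInvariantExtension ι D V f m U F) :
    IsInvariantExtension ι D V' (fun z => f ⟨z.1, hV z.2⟩) m U F :=
  ⟨⟨hF.isOpen, hF.mem, hF.invariant, hF.smooth, fun s hs h => hF.eq s (hV hs) h⟩,
    fun s hs => hF.kills s (hV hs)⟩

theorem mdifferentiableAt (hF : IsInvariantExtension ι D V f m U F) :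
    MDifferentiableAt J 𝓘(ℝ, ℝ) F (ι m) :=
  mdifferentiableAt_of_contMDiffOn hF.isOpen hF.smooth hF.mem

theorem isInvariantOn (hF : IsInvariantExtension ι D V f m U F) (hO : IsOpen O)
    (hOV : ι ⁻¹' O = π_D ⁻¹' V) : IsInvariantOn ι D F (U ∩ O) :=
  ⟨hF.isOpen.inter hO, hF.smooth.mono inter_subset_left,
    fun s hs => hF.kills s (hOV.subset hs.2) hs.1⟩

theorem add (hF : IsInvariantExtension ι D V f m U F)
    (hG : IsInvariantExtension ι D V g m U G) :
    IsInvariantExtension ι D V (f + g) m U (F + G) where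
  isOpen := hF.isOpen
  mem := hF.mem
  invariant := hF.invariant
  smooth := hF.smooth.add hG.smooth
  eq s hs h := congrArg₂ (· + ·) (hF.eq s hs h) (hG.eq s hs h)
  kills s hs h v hv := by
    rw [mvfderiv_add (hF.at_point h).mdifferentiableAt (hG.at_point h).mdifferentiableAt,
      add_apply, hF.kills s hs h v hv, hG.kills s hs h v hv, add_zero]

theorem const_smul (c : ℝ) (hF : IsInvariantExtension ι D V f m U F) :
    IsInvariantExtension ι D V (c • f) m U (c • F) where
  isOpen := hF.isOpen
  mem := hF.mem
  invariant := hF.invariant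
  smooth := (contMDiffOn_const (c := c)).mul hF.smooth
  eq s hs h := congrArg (c * ·) (hF.eq s hs h)
  kills s hs h v hv := by
    rw [mvfderiv_const_smul c (hF.at_point h).mdifferentiableAt, smul_apply,
      hF.kills s hs h v hv, smul_zero]

theorem mul (hF : IsInvariantExtension ι D V f m U F)
    (hG : IsInvariantExtension ι D V g m U G) :
    IsInvariantExtension ι D V (f * g) m U (F * G) where
  isOpen := hF.isOpen
  mem := hF.mem
  invariant := hF.invariant
  smooth := hF.smooth.mul hG.smooth
  eq s hs h := congrArg₂ (· * ·) (hF.eq s hs h) (hG.eq s hs h)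
  kills s hs h v hv := by
    rw [mvfderiv_mul (hF.at_point h).mdifferentiableAt (hG.at_point h).mdifferentiableAt,
      add_apply, smul_apply, smul_apply, hF.kills s hs h v hv, hG.kills s hs h v hv, smul_zero,
      smul_zero, add_zero]

end IsInvariantExtension

theorem IsInvariantOn.isInvariantExtension_zero {k : P → ℝ} (hk : IsInvariantOn ι D k U)
    (hk₀ : ∀ s, ι s ∈ U → k (ι s) = 0)
    (hU : IsInvariantSet (tangentPart (E' := E') ι D) (ι ⁻¹' U)) (hm : ι m ∈ U) :
    IsInvariantExtension ι D V 0 m U k where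
  isOpen := hk.isOpen
  mem := hm
  invariant := hU
  smooth := hk.smooth
  eq s _ hs := (hk₀ s hs).symm
  kills s _ := hk.kills s

section LocalExtensions

variable (hext : HasLocalExtensionProperty (E' := E') ι D)
include hext

theorem HasLocalExtensionProperty.exists_at (hm : π_D m ∈ V) (f : leafFunctions ι D V) :
    ∃ U F, IsInvariantExtension ι D V f.1 m U F := by
  obtain ⟨m', hm', U, F, hF⟩ := hext V f.1 f.2 _ hm
  exact ⟨U, F, hF.at_leaf hm'⟩

theorem HasLocalExtensionProperty.exists_at₂ (hm : π_D m ∈ V) (f g : leafFunctions ι D V) :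
    ∃ U F G, IsInvariantExtension ι D V f.1 m U F ∧ IsInvariantExtension ι D V g.1 m U G := by
  obtain ⟨U, F, hF⟩ := hext.exists_at hm f
  obtain ⟨U', G, hG⟩ := hext.exists_at hm g
  exact ⟨U ∩ U', F, G, hF.inter hG⟩

theorem HasLocalExtensionProperty.exists_at₃ (hm : π_D m ∈ V) (f g h : leafFunctions ι D V) :
    ∃ U F G H, IsInvariantExtension ι D V f.1 m U F ∧ IsInvariantExtension ι D V g.1 m U G ∧
      IsInvariantExtension ι D V h.1 m U H := by
  obtain ⟨U, F, G, hF, hG⟩ := hext.exists_at₂ hm f g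
  obtain ⟨U', H, hH⟩ := hext.exists_at hm h
  exact ⟨U ∩ U', F, G, H, (hF.inter hH).1, hG.inter hH⟩

end LocalExtensions

theorem leafFunctions_ext {f g : leafFunctions ι D V}
    (h : ∀ m (hm : π_D m ∈ V), f.1 ⟨_, hm⟩ = g.1 ⟨_, hm⟩) : f = g :=
  Subtype.ext (funext fun ⟨z, hz⟩ => Quotient.inductionOn z (fun m hm => h m hm) hz)

/-- `φ` is the reduced bracket `{f, g}_V`: its value on each leaf is the bracket of any local
`D`-invariant extensions of `f ∘ π` and `g ∘ π` at any point of the leaf. -/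
def IsReducedBracket (B : PoissonTensor J P) (f g φ : leafFunctions ι D V) : Prop :=
  ∀ (m : S) (hm : π_D m ∈ V) (U : Set P) (F G : P → ℝ),
    IsInvariantExtension ι D V f.1 m U F → IsInvariantExtension ι D V g.1 m U G →
    φ.1 ⟨_, hm⟩ = B.bracket F G (ι m)

variable (ι D) in
/-- The brackets of local `D`-invariant extensions descend to the leaf space, i.e. all reduced
brackets exist; no algebraic property of them is required. -/
def HasReducedBrackets (B : PoissonTensor J P) : Prop :=
  ∀ (V : Opens (LeafSpace (tangentPart (E' := E') ι D))) (f g : leafFunctions ι D V),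
    ∃ φ, IsReducedBracket B f g φ

theorem IsInvariantExtension.bracket {B : PoissonTensor J P} {φ : V → ℝ} {f g : V → ℝ}
    {F G : P → ℝ} (hι : IsInducing ι) (hD : IsPoissonDistribution B ι D)
    (hF : IsInvariantExtension ι D V f m U F) (hG : IsInvariantExtension ι D V g m U G)
    (hφ : ∀ s (hs : π_D s ∈ V), ι s ∈ U → φ ⟨_, hs⟩ = B.bracket F G (ι s)) :
    IsInvariantExtension ι D V φ m U (B.bracket F G) where
  isOpen := hF.isOpen
  mem := hF.mem
  invariant := hF.invariant
  smooth := B.smooth U hF.isOpen F G hF.smooth hG.smooth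
  eq := hφ
  kills s hs hsU := by
    obtain ⟨O, hO, hOV⟩ := exists_isOpen_preimage_eq_preimage_leafProj hι V
    exact ((hF.isInvariantOn hO hOV).bracket hD (hG.isInvariantOn hO hOV)).kills s
      ⟨hsU, hOV.superset hs⟩

namespace IsReducedBracket

variable {B : PoissonTensor J P} {f g h φ ψ χ : leafFunctions ι D V}

theorem isInvariantExtension_bracket {F G : P → ℝ} (hφ : IsReducedBracket B f g φ)
    (hι : IsInducing ι) (hD : IsPoissonDistribution B ι D)
    (hF : IsInvariantExtension ι D V f.1 m U F) (hG : IsInvariantExtension ι D V g.1 m U G) :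
    IsInvariantExtension ι D V φ.1 m U (B.bracket F G) :=
  hF.bracket hι hD hG fun s hs h => hφ s hs U F G (hF.at_point h) (hG.at_point h)

theorem swap (hφ : IsReducedBracket B f g φ) : IsReducedBracket B g f (-φ) :=
  fun m hm U G F hG hF => by
    rw [B.bracket_antisymm, ← hφ m hm U F G hF hG]
    rfl

section Uniqueness

variable (hext : HasLocalExtensionProperty (E' := E') ι D)
include hext

theorem eq_zero_of_self (hφ : IsReducedBracket B f f φ) : φ = 0 := by
  refine leafFunctions_ext fun m hm => ?_
  obtain ⟨U, F, hF⟩ := hext.exists_at hm f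
  rw [hφ m hm U F F hF hF, B.bracket_self]
  rfl

theorem eq_add (hφ : IsReducedBracket B f g φ) (hψ : IsReducedBracket B f h ψ)
    (hχ : IsReducedBracket B f (g + h) χ) : χ = φ + ψ := by
  refine leafFunctions_ext fun m hm => ?_
  obtain ⟨U, F, G, H, hF, hG, hH⟩ := hext.exists_at₃ hm f g h
  change χ.1 ⟨_, hm⟩ = φ.1 ⟨_, hm⟩ + ψ.1 ⟨_, hm⟩
  rw [hχ m hm U F (G + H) hF (hG.add hH), hφ m hm U F G hF hG, hψ m hm U F H hF hH,
    B.bracket_add_right F hG.mdifferentiableAt hH.mdifferentiableAt]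

theorem eq_smul {c : ℝ} (hφ : IsReducedBracket B f g φ) (hψ : IsReducedBracket B f (c • g) ψ) :
    ψ = c • φ := by
  refine leafFunctions_ext fun m hm => ?_
  obtain ⟨U, F, G, hF, hG⟩ := hext.exists_at₂ hm f g
  change ψ.1 ⟨_, hm⟩ = c * φ.1 ⟨_, hm⟩
  rw [hψ m hm U F (c • G) hF (hG.const_smul c), hφ m hm U F G hF hG,
    B.bracket_smul_right c F hG.mdifferentiableAt]

theorem eq_mul_add_mul (hφ : IsReducedBracket B f g φ) (hψ : IsReducedBracket B f h ψ)
    (hχ : IsReducedBracket B f (g * h) χ) : χ = φ * h + g * ψ := by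
  refine leafFunctions_ext fun m hm => ?_
  obtain ⟨U, F, G, H, hF, hG, hH⟩ := hext.exists_at₃ hm f g h
  change χ.1 ⟨_, hm⟩ = φ.1 ⟨_, hm⟩ * h.1 ⟨_, hm⟩ + g.1 ⟨_, hm⟩ * ψ.1 ⟨_, hm⟩
  rw [hχ m hm U F (G * H) hF (hG.mul hH), hφ m hm U F G hF hG, hψ m hm U F H hF hH,
    hG.eq m hm hG.mem, hH.eq m hm hH.mem,
    B.bracket_mul_right F hG.mdifferentiableAt hH.mdifferentiableAt]

theorem leafRestrict_eq {V' : Opens (LeafSpace (tangentPart (E' := E') ι D))} {hV : V' ≤ V}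
    {ψ : leafFunctions ι D V'} (hφ : IsReducedBracket B f g φ)
    (hψ : IsReducedBracket B (leafRestrict ι D hV f) (leafRestrict ι D hV g) ψ) :
    leafRestrict ι D hV φ = ψ := by
  refine leafFunctions_ext fun m hm => ?_
  obtain ⟨U, F, G, hF, hG⟩ := hext.exists_at₂ (hV hm) f g
  exact (hφ m (hV hm) U F G hF hG).trans (hψ m hm U F G (hF.mono hV) (hG.mono hV)).symm

theorem jacobi {φ' ψ' χ' : leafFunctions ι D V} (hι : IsInducing ι)
    (hD : IsPoissonDistribution B ι D) (hφ : IsReducedBracket B g h φ)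
    (hψ : IsReducedBracket B h f ψ) (hχ : IsReducedBracket B f g χ)
    (hφ' : IsReducedBracket B f φ φ') (hψ' : IsReducedBracket B g ψ ψ')
    (hχ' : IsReducedBracket B h χ χ') : φ' + ψ' + χ' = 0 := by
  refine leafFunctions_ext fun m hm => ?_
  obtain ⟨U, F, G, H, hF, hG, hH⟩ := hext.exists_at₃ hm f g h
  change φ'.1 ⟨_, hm⟩ + ψ'.1 ⟨_, hm⟩ + χ'.1 ⟨_, hm⟩ = 0
  rw [hφ' m hm U F _ hF (hφ.isInvariantExtension_bracket hι hD hG hH),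
    hψ' m hm U G _ hG (hψ.isInvariantExtension_bracket hι hD hH hF),
    hχ' m hm U H _ hH (hχ.isInvariantExtension_bracket hι hD hF hG),
    B.bracket_jacobi hF.isOpen hF.smooth hG.smooth hH.smooth hF.mem]

end Uniqueness

end IsReducedBracket

variable {B : PoissonTensor J P}

theorem isPoissonReducible_iff_hasReducedBrackets (hι : IsInducing ι)
    (hD : IsPoissonDistribution B ι D) (hext : HasLocalExtensionProperty (E' := E') ι D) :
    IsPoissonReducible (E' := E') B ι D ↔ HasReducedBrackets (E' := E') ι D B := by
  refine ⟨fun ⟨br, hbr, _⟩ V f g => ⟨br V f g, hbr V f g⟩, fun h => ?_⟩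
  choose br hbr using h
  have add_right : ∀ V f g h, br V f (g + h) = br V f g + br V f h := fun V f g h =>
    (hbr V f g).eq_add hext (hbr V f h) (hbr V f (g + h))
  have smul_right : ∀ V (c : ℝ) f g, br V f (c • g) = c • br V f g := fun V c f g =>
    (hbr V f g).eq_smul hext (hbr V f (c • g))
  have add_left : ∀ V f g h, br V (f + g) h = br V f h + br V g h := fun V f g h => by
    rw [← neg_inj, neg_add]
    exact (hbr V f h).swap.eq_add hext (hbr V g h).swap (hbr V (f + g) h).swap
  have smul_left : ∀ V (c : ℝ) f g, br V (c • f) g = c • br V f g := fun V c f g => by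
    rw [← neg_inj, ← smul_neg]
    exact (hbr V f g).swap.eq_smul hext (hbr V (c • f) g).swap
  exact ⟨fun V => LinearMap.mk₂ ℝ (br V) (add_left V) (smul_left V) (add_right V) (smul_right V),
    hbr, fun V f => (hbr V f f).eq_zero_of_self hext,
    fun V f g h => IsReducedBracket.jacobi hext hι hD (hbr V g h) (hbr V h f) (hbr V f g)
      (hbr V f _) (hbr V g _) (hbr V h _),
    fun V f g h => (hbr V f g).eq_mul_add_mul hext (hbr V f h) (hbr V f (g * h)),
    fun V V' hV f g => (hbr V f g).leafRestrict_eq hext (hbr V' _ _)⟩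

end ReducedBracket

section Sufficiency

variable {EP HP P : Type*} [NormedAddCommGroup EP] [NormedSpace ℝ EP]
  [TopologicalSpace HP] {J : ModelWithCorners ℝ EP HP}
  [TopologicalSpace P] [ChartedSpace HP P]
  {E' S : Type*} [NormedAddCommGroup E'] [NormedSpace ℝ E']
  [TopologicalSpace S] [ChartedSpace E' S] [IsManifold 𝓘(ℝ, E') ∞ S]
  {ι : S → P} {D : ∀ s : S, Submodule ℝ (TangentSpace J (ι s))} {B : PoissonTensor J P}

local notation "π_D" => leafProj (tangentPart (E' := E') ι D)

namespace IsInvariantExtension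

variable {V : Opens (LeafSpace (tangentPart (E' := E') ι D))} {f g : V → ℝ} {m m' : S}
  {U U' U'' : Set P} {F F' G G' : P → ℝ}

theorem bracket_congr_right (hι : IsInducing ι) (hB : BracketVanishesAt B ι D m)
    (hm : π_D m ∈ V) (hF : IsInvariantExtension ι D V f m U F)
    (hG : IsInvariantExtension ι D V g m U' G) (hG' : IsInvariantExtension ι D V g m U'' G') :
    B.bracket F G (ι m) = B.bracket F G' (ι m) := by
  obtain ⟨O, hO, hOV⟩ := exists_isOpen_preimage_eq_preimage_leafProj hι V
  have hmO : ι m ∈ O := hOV.superset hm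
  have hF₁ := (hF.inter (hG.inter hG').1).1.isInvariantOn hO hOV
  have hG₁ := (hF.inter (hG.inter hG').1).2.isInvariantOn hO hOV
  have hG₁' := (hF.inter (hG.inter hG').2).2.isInvariantOn hO hOV
  have hvanish : ∀ s, ι s ∈ U ∩ (U' ∩ U'') ∩ O → (G - G') (ι s) = 0 := fun s hs =>
    sub_eq_zero.2 ((hG.eq s (hOV.subset hs.2) hs.1.2.1).symm.trans
      (hG'.eq s (hOV.subset hs.2) hs.1.2.2))
  rw [← sub_eq_zero, ← B.bracket_sub_right F hG.mdifferentiableAt hG'.mdifferentiableAt]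
  exact hB _ F (G - G') hF₁ (hG₁.sub hG₁') hvanish ⟨⟨hF.mem, hG.mem, hG'.mem⟩, hmO⟩

theorem bracket_congr (hι : IsInducing ι) (hB : BracketVanishesAt B ι D m) (hm : π_D m ∈ V)
    (hF : IsInvariantExtension ι D V f m U F) (hG : IsInvariantExtension ι D V g m U G)
    (hF' : IsInvariantExtension ι D V f m U' F') (hG' : IsInvariantExtension ι D V g m U' G') :
    B.bracket F G (ι m) = B.bracket F' G' (ι m) := by
  rw [hF.bracket_congr_right hι hB hm hG hG', B.bracket_antisymm F,
    hG'.bracket_congr_right hι hB hm hF hF', ← B.bracket_antisymm F']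

theorem bracket_eq_of_leafProj_eq (hι : IsEmbeddedSubmanifold (E' := E') J ι)
    (hD : IsPoissonDistribution B ι D) (hm : π_D m ∈ V)
    (hF : IsInvariantExtension ι D V f m U F) (hG : IsInvariantExtension ι D V g m U G)
    (h : π_D m = π_D m') : B.bracket F G (ι m') = B.bracket F G (ι m) := by
  obtain ⟨O, hO, hOV⟩ := exists_isOpen_preimage_eq_preimage_leafProj hι.isEmbedding.isInducing V
  refine ((hF.isInvariantOn hO hOV).bracket hD (hG.isInvariantOn hO hOV)).apply_eq_of_leafProj_eq
    hι.smooth ?_ ⟨hF.mem, hOV.superset hm⟩ h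
  rw [preimage_inter, hOV]
  exact hF.invariant.inter (isInvariantSet_preimage_leafProj (Δ := tangentPart (E' := E') ι D) V)

end IsInvariantExtension

theorem hasReducedBrackets_of_bracketVanishesAt (hι : IsEmbeddedSubmanifold (E' := E') J ι)
    (hD : IsPoissonDistribution B ι D) (hext : HasLocalExtensionProperty (E' := E') ι D)
    (hB : ∀ z, BracketVanishesAt B ι D z) : HasReducedBrackets (E' := E') ι D B := by
  intro V f g
  have hιi := hι.isEmbedding.isInducing
  have hout : ∀ z : V, π_D z.1.out = z.1 := fun z => Quotient.out_eq _
  choose U F G hF hG using fun z : V => hext.exists_at₂ ((hout z).symm ▸ z.2) f g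
  have hφ : ∀ m (hm : π_D m ∈ V) (U' : Set P) (F' G' : P → ℝ),
      IsInvariantExtension ι D V f.1 m U' F' → IsInvariantExtension ι D V g.1 m U' G' →
      B.bracket (F ⟨_, hm⟩) (G ⟨_, hm⟩) (ι (π_D m).out) = B.bracket F' G' (ι m) := by
    intro m hm U' F' G' hF' hG'
    rw [← (hF ⟨_, hm⟩).bracket_eq_of_leafProj_eq hι hD ((hout ⟨_, hm⟩).symm ▸ hm) (hG ⟨_, hm⟩)
      (hout ⟨_, hm⟩)]
    exact ((hF ⟨_, hm⟩).at_leaf (hout ⟨_, hm⟩)).bracket_congr hιi (hB m) hm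
      ((hG ⟨_, hm⟩).at_leaf (hout ⟨_, hm⟩)) hF' hG'
  refine ⟨⟨fun z => B.bracket (F z) (G z) (ι z.1.out), fun z hz => ?_⟩, hφ⟩
  exact ⟨_, hout ⟨z, hz⟩, U ⟨z, hz⟩, _, ((hF ⟨z, hz⟩).bracket hιi hD (hG ⟨z, hz⟩)
    fun s hs h => hφ s hs _ _ _ ((hF _).at_point h) ((hG _).at_point h)).toIsLocalExtension⟩

end Sufficiency

section Necessity

variable {EP HP P : Type*} [NormedAddCommGroup EP] [NormedSpace ℝ EP]
  [TopologicalSpace HP] {J : ModelWithCorners ℝ EP HP}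
  [TopologicalSpace P] [ChartedSpace HP P]
  {S : Type*} {ι : S → P} {D : ∀ s : S, Submodule ℝ (TangentSpace J (ι s))}
  {B : PoissonTensor J P} {z : S}

theorem bracketVanishesAt_of_ne_bot [IsManifold J ∞ P] (hD : IsPoissonDistribution B ι D)
    (hz : D z ≠ ⊥) : BracketVanishesAt B ι D z := by
  intro U f k hf hk hk₀ hzU
  obtain ⟨v, hv, hv₀⟩ := (D z).exists_mem_ne_zero_of_ne_bot hz
  obtain ⟨O, a, hO, hzO, ha, hav⟩ := exists_contMDiffOn_mvfderiv_ne_zero (ι z) hv₀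
  have hUO : IsOpen (U ∩ O) := hk.isOpen.inter hO
  have hf' := hf.mono hUO inter_subset_left
  have hk' := hk.mono hUO inter_subset_left
  have ha' := ha.mono (inter_subset_right (s := U))
  have hzUO : ι z ∈ U ∩ O := ⟨hzU, hzO⟩
  have had : ∀ x ∈ U ∩ O, MDifferentiableAt J 𝓘(ℝ, ℝ) a x := fun x hx =>
    mdifferentiableAt_of_contMDiffOn hUO ha' hx
  have hfk := hf'.bracket hD hk'
  have hfak := hf'.bracket hD (.mul_of_eq_zero ha' hk' fun s hs => hk₀ s hs.1)
  have hleibniz : B.bracket f (a * k) =ᶠ[𝓝 (ι z)] B.bracket f a * k + a * B.bracket f k :=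
    Filter.eventuallyEq_of_mem (hUO.mem_nhds hzUO) fun x hx =>
      B.bracket_mul_right f (had x hx) (hk'.mdifferentiableAt hx)
  have hfad : MDifferentiableAt J 𝓘(ℝ, ℝ) (B.bracket f a) (ι z) :=
    mdifferentiableAt_of_contMDiffOn hUO (B.smooth _ hUO f a hf'.smooth ha') hzUO
  have hkd := hk'.mdifferentiableAt hzUO
  have hfkd := hfk.mdifferentiableAt hzUO
  have h := hfak.kills z hzUO v hv
  rw [mvfderiv, hleibniz.mfderiv_eq] at h
  change mvfderiv J (B.bracket f a * k + a * B.bracket f k) (ι z) v = 0 at h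
  rw [mvfderiv_add (hfad.mul hkd) ((had _ hzUO).mul hfkd), mvfderiv_mul hfad hkd,
    mvfderiv_mul (had _ hzUO) hfkd] at h
  simp only [add_apply, smul_apply, hk'.kills z hzUO v hv, hfk.kills z hzUO v hv, hk₀ z hzU,
    smul_eq_mul, mul_zero, zero_mul, zero_add] at h
  exact (mul_eq_zero.1 h).resolve_right hav

theorem isClosed_setOf_bracketVanishesAt [TopologicalSpace S] (hι : Continuous ι) :
    IsClosed {z | BracketVanishesAt B ι D z} := by
  refine isClosed_iff_frequently.2 fun z hfreq U f k hf hk hk₀ hzU => ?_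
  have hUz : ι ⁻¹' U ∈ 𝓝 z := (hf.isOpen.preimage hι).mem_nhds hzU
  have hcont : ContinuousAt (fun s => B.bracket f k (ι s)) z :=
    ((B.smooth U hf.isOpen f k hf.smooth hk.smooth).continuousOn.continuousAt
      (hf.isOpen.mem_nhds hzU)).comp hι.continuousAt
  refine isClosed_singleton.mem_of_frequently_of_tendsto ?_ hcont
  exact (hfreq.and_eventually hUz).mono fun s hs => hs.1 U f k hf hk hk₀ hs.2

variable {E' : Type*} [NormedAddCommGroup E'] [NormedSpace ℝ E']
  [TopologicalSpace S] [ChartedSpace E' S] [IsManifold 𝓘(ℝ, E') ∞ S]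

theorem IsInvariantOn.exists_isInvariantExtension_of_eq_bot {f : P → ℝ} {U : Set P}
    (hι : Continuous ι) (hf : IsInvariantOn ι D f U)
    (hbot : ∀ s, ι s ∈ U → tangentPart (E' := E') ι D s = ⊥) :
    ∃ (V : Opens (LeafSpace (tangentPart (E' := E') ι D))) (φ : leafFunctions ι D V),
      ∀ s, ι s ∈ U → leafProj _ s ∈ V ∧ IsInvariantExtension ι D V φ.1 s U f := by
  have hA : IsOpen (ι ⁻¹' U) := hf.isOpen.preimage hι
  have hpre := preimage_image_leafProj_of_eq_bot hA hbot
  let V : Opens (LeafSpace (tangentPart (E' := E') ι D)) :=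
    ⟨leafProj _ '' (ι ⁻¹' U), isOpen_image_leafProj_of_eq_bot hA hbot⟩
  let φ : V → ℝ := fun w => f (ι w.1.out)
  have hφ : ∀ s, ι s ∈ U → IsInvariantExtension ι D V φ s U f := fun s hs =>
    { isOpen := hf.isOpen
      mem := hs
      invariant := hpre ▸ isInvariantSet_preimage_leafProj _
      smooth := hf.smooth
      eq := fun s' _ hs' => congrArg (f ∘ ι)
        (leafProj_out_of_eventually_eq_bot (Filter.mem_of_superset (hA.mem_nhds hs') hbot))
      kills := fun s' _ => hf.kills s' }
  refine ⟨V, ⟨φ, ?_⟩, fun s hs => ⟨mem_image_of_mem _ hs, hφ s hs⟩⟩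
  rintro _ ⟨s, hs, rfl⟩
  exact ⟨s, rfl, U, f, (hφ s hs).toIsLocalExtension⟩

theorem HasReducedBrackets.bracketVanishesAt_of_eventually_eq_bot
    (hred : HasReducedBrackets (E' := E') ι D B) (hι : IsEmbeddedSubmanifold (E' := E') J ι)
    (hz : ∀ᶠ s in 𝓝 z, D s = ⊥) : BracketVanishesAt B ι D z := by
  intro U f k hf hk hk₀ hzU
  obtain ⟨O, ⟨hzO, hO⟩, hbot⟩ :=
    (hι.isEmbedding.isInducing.basis_nhds (nhds_basis_opens (ι z))).mem_iff.1 hz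
  have hbot' : ∀ s, ι s ∈ U ∩ O → tangentPart (E' := E') ι D s = ⊥ := fun s hs =>
    tangentPart_eq_bot hι (hbot hs.2)
  have hUO : IsOpen (U ∩ O) := hf.isOpen.inter hO
  obtain ⟨V, φ, hφ⟩ := (hf.mono hUO inter_subset_left).exists_isInvariantExtension_of_eq_bot
    hι.isEmbedding.continuous hbot'
  obtain ⟨hzV, hF⟩ := hφ z ⟨hzU, hzO⟩
  have hK : IsInvariantExtension ι D V 0 z (U ∩ O) k :=
    (hk.mono hUO inter_subset_left).isInvariantExtension_zero (fun s hs => hk₀ s hs.1)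
      hF.invariant hF.mem
  have h0 : IsInvariantExtension ι D V 0 z (U ∩ O) 0 :=
    (IsInvariantOn.const 0 hUO).isInvariantExtension_zero (fun _ _ => rfl) hF.invariant hF.mem
  obtain ⟨ψ, hψ⟩ := hred V φ 0
  calc B.bracket f k (ι z) = ψ.1 ⟨_, hzV⟩ := (hψ z hzV _ f k hF hK).symm
    _ = B.bracket f 0 (ι z) := hψ z hzV _ f 0 hF h0
    _ = 0 := B.bracket_zero_right f (ι z)

theorem HasReducedBrackets.bracketVanishesAt [IsManifold J ∞ P]
    (hred : HasReducedBrackets (E' := E') ι D B) (hι : IsEmbeddedSubmanifold (E' := E') J ι)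
    (hD : IsPoissonDistribution B ι D) (z : S) : BracketVanishesAt B ι D z := by
  by_cases hz : ∃ᶠ s in 𝓝 z, D s ≠ ⊥
  · exact isClosed_iff_frequently.1
      (isClosed_setOf_bracketVanishesAt hι.isEmbedding.continuous) z
      (hz.mono fun s => bracketVanishesAt_of_ne_bot hD)
  · exact hred.bracketVanishesAt_of_eventually_eq_bot hι (by simpa using hz)

end Necessity

end PoissonReduction

theorem theorem3p4_general
    {EP HP P : Type*} [NormedAddCommGroup EP] [NormedSpace ℝ EP] [TopologicalSpace HP]
    {J : ModelWithCorners ℝ EP HP} [TopologicalSpace P] [ChartedSpace HP P] [IsManifold J ∞ P]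
    {E' S : Type*} [NormedAddCommGroup E'] [NormedSpace ℝ E']
    [TopologicalSpace S] [ChartedSpace E' S] [IsManifold 𝓘(ℝ, E') ∞ S]
    (B : PoissonTensor J P) {ι : S → P} (hι : IsEmbeddedSubmanifold (E' := E') J ι)
    (D : ∀ s : S, Submodule ℝ (TangentSpace J (ι s))) (hD : IsPoissonDistribution B ι D)
    (hext : HasLocalExtensionProperty (E' := E') ι D) :
    IsPoissonReducible (E' := E') B ι D ↔
      ∀ z : S, B.sharp (ι z) '' deltaAt ι D z ⊆ annihilator (deltaConstAt ι D z) := by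
  rw [isPoissonReducible_iff_hasReducedBrackets hι.isEmbedding.isInducing hD hext]
  simp only [sharp_image_deltaAt_subset_annihilator_iff]
  exact ⟨fun hred => hred.bracketVanishesAt hι hD,
    hasReducedBrackets_of_bracketVanishesAt hι hD hext⟩

theorem theorem3p4
    {E : Type*} [NormedAddCommGroup E] [NormedSpace ℝ E] [FiniteDimensional ℝ E]
    {Q : Type*} [TopologicalSpace Q] [T2Space Q] [SecondCountableTopology Q]
    [ChartedSpace E Q] [IsManifold 𝓘(ℝ, E) ∞ Q]
    {E' : Type*} [NormedAddCommGroup E'] [NormedSpace ℝ E'] [FiniteDimensional ℝ E']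
    {W : Type*} [TopologicalSpace W] [T2Space W] [SecondCountableTopology W]
    [ChartedSpace E' W] [IsManifold 𝓘(ℝ, E') ∞ W]
    (K : HorizontalSplitting E Q) (S : CHSystem E Q E' W)
    (hW : S.IsControllabilitySubmanifold K)
    (D : ∀ w : W, Submodule ℝ (TangentSpace (cotModel E) (S.ι w)))
    (hD : S.IsControllabilityDistribution K D)
    (hsmooth : IsSmoothDistribution (tangentPart (E' := E') S.ι D))
    (hregular : IsRegularDistribution (tangentPart (E' := E') S.ι D))
    (hintegrable : IsIntegrableDistribution (tangentPart (E' := E') S.ι D))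
    (hext : HasLocalExtensionProperty (E' := E') S.ι D) :
    S.IsPoissonReducibleBy D ↔
      ∀ z : W, S.B.sharp (S.ι z) '' deltaAt S.ι D z ⊆ annihilator (deltaConstAt S.ι D z) :=
  theorem3p4_general S.B S.submanifold D hD.poisson hext
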